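/- Let $\mathcal C$ be a category with a terminal object $1$ and binary products, and let $\mathcal M$ be a dominion on $\mathcal C$, i.e. a class of monomorphisms that contains all identities, is closed under composition, and is such that pullbacks of $\mathcal M$-morphisms along arbitrary morphisms exist and are in $\mathcal M$. Let $\mathbf P(\mathcal C,\mathcal M)$ be the category of partial morphisms: its objects are those of $\mathcal C$; its morphisms $X\rightharpoonup Y$ are spans $X\xleftarrow{m}D\xrightarrow{f}Y$ with $m\in\mathcal M$, modulo isomorphic change of $D$; composition is by pullback. Assume that $(\mathcal C,\mathcal M)$ is a partial cartesian closed category with equality, i.e. for every object $A$ the functor $\mathcal C\xrightarrow{-\times A}\mathcal C\hookrightarrow\mathbf P(\mathcal C,\mathcal M)$ (the embedding being $f\mapsto(\mathrm{id},f)$) has a right adjoint, and $\mathcal M$ contains all diagonals $A\to A\times A$. Then the following are equivalent: 1. $\mathcal C$ has disjoint finite coproducts, i.e. $\mathcal C$ has finite coproducts and the pullback of any two distinct injections of a finite coproduct (injections with different indices) is an initial object; 2. $\mathcal C$ has finite coproducts, the pullback of any two distinct injections of a finite coproduct is an initial object, and all injections of finite coproducts are monomorphisms; 3. $\mathcal C$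 has an initial object $0$, the coproduct $1+1$ exists in $\mathcal C$, and the morphism $0\to1$ is a regular monomorphism; 4. $\mathcal C$ has an initial object $0$, which is strict (every morphism into it is an isomorphism), the coproduct $1+1$ exists in $\mathcal C$, and the morphism $0\to1$ is a regular monomorphism. -/

import Mathlib

open CategoryTheory CategoryTheory.Limits

universe v u

namespace PartialCat

/-- A dominion on `C`: a class of monomorphisms which contains all identities, is closed under
composition, and such that pullbacks of its members along arbitrary morphisms exist and belong
to the class. -/
class IsDominion {C : Type u} [Category.{v} C] (M : MorphismProperty C) : Prop
    extends M.IsMultiplicative, M.IsStableUnderBaseChange, M.HasPullbacks where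
  mono {X Y : C} (m : X ⟶ Y) : M m → Mono m

/-- A span `X ↩ D → Y` whose left leg belongs to `M`. -/
structure PartialSpan {C : Type u} [Category.{v} C] (M : MorphismProperty C) (X Y : C) where
  /-- the domain of definition -/
  dom : C
  /-- the inclusion of the domain of definition -/
  incl : dom ⟶ X
  mem : M incl
  /-- the underlying morphism -/
  map : dom ⟶ Y

namespace PartialSpan

variable {C : Type u} [Category.{v} C] {M : MorphismProperty C}

/-- Two spans are identified if they differ by an isomorphic change of the domain. -/
def Equiv {X Y : C} (s t : PartialSpan M X Y) : Prop :=
  ∃ e : s.dom ≅ t.dom, e.hom ≫ t.incl = s.incl ∧ e.hom ≫ t.map = s.map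

instance setoid (M : MorphismProperty C) (X Y : C) : Setoid (PartialSpan M X Y) where
  r := Equiv
  iseqv :=
    { refl := fun s => ⟨Iso.refl _, by simp, by simp⟩
      symm := by
        rintro s t ⟨e, h₁, h₂⟩
        exact ⟨e.symm, by simp [← h₁], by simp [← h₂]⟩
      trans := by
        rintro s t r ⟨e, h₁, h₂⟩ ⟨e', h₁', h₂'⟩
        exact ⟨e ≪≫ e', by simp [h₁, h₁'], by simp [h₂, h₂']⟩ }

/-- The span `(id, f)` of a morphism `f`. -/
def ofHom (M : MorphismProperty C) [IsDominion M] {X Y : C} (f : X ⟶ Y) :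
    PartialSpan M X Y where
  dom := X
  incl := 𝟙 X
  mem := M.id_mem X
  map := f

/-- The composite of two spans along a given pullback square. -/
def compOfIsPullback [IsDominion M] {X Y Z : C} (s : PartialSpan M X Y) (t : PartialSpan M Y Z)
    {P : C} {p : P ⟶ t.dom} {q : P ⟶ s.dom} (h : IsPullback p q t.incl s.map) :
    PartialSpan M X Z where
  dom := P
  incl := q ≫ s.incl
  mem := M.comp_mem _ _ (MorphismProperty.of_isPullback h t.mem) s.mem
  map := p ≫ t.map

theorem isPullback [IsDominion M] {X Y Z : C} (s : PartialSpan M X Y) (t : PartialSpan M Y Z) :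
    haveI := M.hasPullback s.map t.mem
    IsPullback (pullback.fst t.incl s.map) (pullback.snd t.incl s.map) t.incl s.map :=
  haveI := M.hasPullback s.map t.mem
  IsPullback.of_hasPullback _ _

/-- Composition of spans by pullback formation. -/
noncomputable def comp [IsDominion M] {X Y Z : C} (s : PartialSpan M X Y)
    (t : PartialSpan M Y Z) : PartialSpan M X Z :=
  compOfIsPullback s t (isPullback s t)

/-- The composite does not depend on the chosen pullback nor on the representatives. -/
theorem compOfIsPullback_equiv [IsDominion M] {X Y Z : C} {s s' : PartialSpan M X Y}
    {t t' : PartialSpan M Y Z} (hs : s ≈ s') (ht : t ≈ t')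
    {P : C} {p : P ⟶ t.dom} {q : P ⟶ s.dom} (h : IsPullback p q t.incl s.map)
    {P' : C} {p' : P' ⟶ t'.dom} {q' : P' ⟶ s'.dom} (h' : IsPullback p' q' t'.incl s'.map) :
    compOfIsPullback s t h ≈ compOfIsPullback s' t' h' := by
  obtain ⟨e, he₁, he₂⟩ := hs
  obtain ⟨d, hd₁, hd₂⟩ := ht
  have h'' : IsPullback (p ≫ d.hom) (q ≫ e.hom) t'.incl s'.map :=
    IsPullback.of_iso h (Iso.refl _) d e (Iso.refl _) (by simp) (by simp)
      (by simp [hd₁]) (by simp [he₂])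
  refine ⟨h''.isoIsPullback _ _ h', ?_, ?_⟩
  · simp [compOfIsPullback, ← he₁]
  · simp [compOfIsPullback, ← hd₂]

end PartialSpan

/-- The category `P(C, M)` of partial morphisms has the same objects as `C`. -/
structure Par {C : Type u} [Category.{v} C] (M : MorphismProperty C) where
  /-- the underlying object of `C` -/
  obj : C

/-- A partial morphism `X ⇀ Y` is a span with left leg in `M`, up to isomorphic change of its
domain of definition. -/
def PartialHom {C : Type u} [Category.{v} C] (M : MorphismProperty C) (X Y : C) :
    Type (max u v) :=
  Quotient (PartialSpan.setoid M X Y)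

/-- Composition of partial morphisms. -/
noncomputable def PartialHom.comp {C : Type u} [Category.{v} C] {M : MorphismProperty C}
    [IsDominion M] {X Y Z : C} : PartialHom M X Y → PartialHom M Y Z → PartialHom M X Z :=
  Quotient.map₂ PartialSpan.comp fun _ _ hs _ _ ht =>
    PartialSpan.compOfIsPullback_equiv hs ht _ _

/-- The category of partial morphisms of the dominional category `(C, M)`. -/
noncomputable instance Par.category {C : Type u} [Category.{v} C] (M : MorphismProperty C)
    [IsDominion M] : Category.{max u v} (Par M) where
  Hom X Y := PartialHom M X.obj Y.obj
  id X := ⟦PartialSpan.ofHom M (𝟙 X.obj)⟧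
  comp f g := PartialHom.comp f g
  id_comp := by
    rintro X Y ⟨s⟩
    refine Quotient.sound ?_
    have h : IsPullback (𝟙 s.dom) s.incl s.incl (𝟙 X.obj) :=
      IsPullback.of_horiz_isIso ⟨by simp⟩
    refine Setoid.trans (PartialSpan.compOfIsPullback_equiv (Setoid.refl _) (Setoid.refl _) _ h) ?_
    exact ⟨Iso.refl _, by simp [PartialSpan.compOfIsPullback, PartialSpan.ofHom],
      by simp [PartialSpan.compOfIsPullback]⟩
  comp_id := by
    rintro X Y ⟨s⟩
    refine Quotient.sound ?_
    have h : IsPullback s.map (𝟙 s.dom) (𝟙 Y.obj) s.map :=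
      IsPullback.of_vert_isIso ⟨by simp⟩
    refine Setoid.trans (PartialSpan.compOfIsPullback_equiv (Setoid.refl _) (Setoid.refl _) _ h) ?_
    exact ⟨Iso.refl _, by simp [PartialSpan.compOfIsPullback],
      by simp [PartialSpan.compOfIsPullback, PartialSpan.ofHom]⟩
  assoc := by
    rintro W X Y Z ⟨r⟩ ⟨s⟩ ⟨t⟩
    refine Quotient.sound ?_
    have h₁ := PartialSpan.isPullback r s
    have h₂ := PartialSpan.isPullback s t
    have := M.hasPullback s.map t.mem
    have := M.hasPullback r.map s.mem
    have : HasPullback (pullback.snd t.incl s.map) (pullback.fst s.incl r.map) :=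
      M.hasPullback _ (MorphismProperty.of_isPullback h₂ t.mem)
    have h₃ := IsPullback.of_hasPullback (pullback.snd t.incl s.map) (pullback.fst s.incl r.map)
    have hl : IsPullback
        (pullback.fst (pullback.snd t.incl s.map) (pullback.fst s.incl r.map) ≫
          pullback.fst t.incl s.map)
        (pullback.snd (pullback.snd t.incl s.map) (pullback.fst s.incl r.map))
        t.incl (PartialSpan.comp r s).map :=
      (h₃.flip.paste_vert h₂.flip).flip
    have hr : IsPullback
        (pullback.fst (pullback.snd t.incl s.map) (pullback.fst s.incl r.map))
        (pullback.snd (pullback.snd t.incl s.map) (pullback.fst s.incl r.map) ≫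
          pullback.snd s.incl r.map)
        (PartialSpan.comp s t).incl r.map :=
      h₃.paste_vert h₁
    refine Setoid.trans (PartialSpan.compOfIsPullback_equiv (Setoid.refl _) (Setoid.refl _) _ hl)
      (Setoid.trans ?_ (PartialSpan.compOfIsPullback_equiv (Setoid.refl _) (Setoid.refl _) hr _))
    exact ⟨Iso.refl _, by simp [PartialSpan.compOfIsPullback, PartialSpan.comp],
      by simp [PartialSpan.compOfIsPullback, PartialSpan.comp]⟩

/-- The embedding of `C` into its category of partial morphisms, `f ↦ (id, f)`. -/
noncomputable def embedding {C : Type u} [Category.{v} C] (M : MorphismProperty C)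
    [IsDominion M] : C ⥤ Par M where
  obj X := ⟨X⟩
  map f := (⟦PartialSpan.ofHom M f⟧ : PartialHom M _ _)
  map_id _ := rfl
  map_comp {X Y Z} f g := by
    refine Quotient.sound ?_
    have h : IsPullback f (𝟙 X) (𝟙 Y) f :=
      IsPullback.of_vert_isIso ⟨by simp⟩
    refine Setoid.trans ?_
      (PartialSpan.compOfIsPullback_equiv (Setoid.refl _) (Setoid.refl _) h _)
    exact ⟨Iso.refl _, by simp [PartialSpan.compOfIsPullback, PartialSpan.ofHom],
      by simp [PartialSpan.compOfIsPullback, PartialSpan.ofHom]⟩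

/-- The dominional category `(C, M)`, with `C` cartesian, is a partial cartesian closed category:
for each object `A`, the functor `- × A : C ⥤ C` followed by the embedding `C ⥤ P(C, M)` has a
right adjoint. -/
def IsPCCC {C : Type u} [Category.{v} C] [HasTerminal C] [HasBinaryProducts C]
    (M : MorphismProperty C) [IsDominion M] : Prop :=
  ∀ A : C, (prod.functor.flip.obj A ⋙ embedding M).IsLeftAdjoint

/-- A partial cartesian closed category with equality: in addition, all diagonals
`A ⟶ A × A` belong to `M`. -/
structure IsPCCCWithEquality {C : Type u} [Category.{v} C] [HasTerminal C] [HasBinaryProducts C]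
    (M : MorphismProperty C) [IsDominion M] : Prop where
  isPCCC : IsPCCC M
  diag_mem (A : C) : M (diag A)

/-- `C` has finite coproducts, and the pullback of any two distinct coproduct injections exists
and is an initial object. -/
structure HasDisjointFiniteCoproducts (C : Type u) [Category.{v} C] : Prop where
  hasFiniteCoproducts : HasFiniteCoproducts C
  isPullback_initial {ι : Type} [Finite ι] {X : ι → C} (c : Cofan X) (hc : IsColimit c)
    {i j : ι} (hij : i ≠ j) :
    ∃ (Z : C) (p : Z ⟶ X i) (q : Z ⟶ X j),
      IsPullback p q (c.inj i) (c.inj j) ∧ Nonempty (IsInitial Z)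

end PartialCat

/-! A left adjoint preserves coproducts, so partial maps out of `(∐ S i) ⨯ d` are the same as
families of partial maps out of the `S i ⨯ d` (`IsPCCC.span_ext`, `IsPCCC.exists_span`). Since
diagonals lie in `M`, so do sections; in particular the graph of any `h : d ⟶ ∐ S i` is a legitimate
domain in `(∐ S i) ⨯ d`, and its restriction to `S i ⨯ d` is the pullback of the `i`-th injection
along `h`. Hence coproducts are universal (`nonempty_isColimit_of_isPullback`).

The empty coproduct gives strictness of `0`. Pulling a coproduct back along one of its own
injections shows that disjointness makes the injections monic.

If `0 ⟶ 1` is regular mono, it lies in `M`, so nowhere-defined partial maps exist. Through partial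
map classifiers, any `A` and `B` then embed in a common object `Q`. Gluing them as subobjects over
the two copies of `Q` in `(1 + 1) ⨯ Q` yields `A + B`. Disjointness follows by mapping the coproduct
to the parallel pair whose equalizer is `0 ⟶ 1`. -/

namespace PartialCat

variable {C : Type u} [Category.{v} C] {M : MorphismProperty C}

/-! ### Restriction of partial maps as pullback of domains -/

section Dominion

variable [IsDominion M]

/-- The partial morphism represented by a span. -/
def PartialSpan.toHom {X Y : C} (s : PartialSpan M X Y) : (Par.mk X : Par M) ⟶ Par.mk Y :=
  (⟦s⟧ : PartialHom M X Y)

theorem PartialSpan.exists_toHom_eq {X Y : C} (f : (Par.mk X : Par M) ⟶ Par.mk Y) :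
    ∃ s : PartialSpan M X Y, s.toHom = f :=
  Quotient.exists_rep (f : PartialHom M X Y)

theorem PartialSpan.toHom_eq_iff {X Y : C} (s t : PartialSpan M X Y) :
    s.toHom = t.toHom ↔ ∃ e : s.dom ≅ t.dom, e.hom ≫ t.incl = s.incl ∧ e.hom ≫ t.map = s.map :=
  Quotient.eq (r := PartialSpan.setoid M X Y)

theorem PartialSpan.map_comp_toHom {T X Y : C} (f : T ⟶ X) (t : PartialSpan M X Y)
    {P : C} {p : P ⟶ t.dom} {q : P ⟶ T} (h : IsPullback p q t.incl f) :
    ((embedding M).map f ≫ t.toHom : (Par.mk T : Par M) ⟶ Par.mk Y) =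
      PartialSpan.toHom ⟨P, q, M.of_isPullback h t.mem, p ≫ t.map⟩ := by
  refine Quotient.sound (Setoid.trans (compOfIsPullback_equiv (s := ofHom M f) (t := t)
    (Setoid.refl _) (Setoid.refl _) _ h) ?_)
  exact ⟨Iso.refl _, by simp [compOfIsPullback, ofHom], by simp [compOfIsPullback]⟩

/-- Restricting a partial morphism along `f` is pulling back its domain along `f`. -/
theorem PartialSpan.map_comp_toHom_eq_iff {T X Y : C} (f : T ⟶ X) (t : PartialSpan M X Y)
    (s : PartialSpan M T Y) :
    ((embedding M).map f ≫ t.toHom : (Par.mk T : Par M) ⟶ Par.mk Y) = s.toHom ↔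
      ∃ p : s.dom ⟶ t.dom, IsPullback p s.incl t.incl f ∧ p ≫ t.map = s.map := by
  have := M.hasPullback f t.mem
  have hpb := IsPullback.of_hasPullback t.incl f
  constructor
  · rw [map_comp_toHom f t hpb, toHom_eq_iff]
    rintro ⟨e, h₁, h₂⟩
    dsimp at e h₁ h₂
    exact ⟨e.inv ≫ pullback.fst _ _, IsPullback.of_iso hpb e (Iso.refl _) (Iso.refl _)
      (Iso.refl _) (by simp) (by simp [h₁]) (by simp) (by simp), by simp [← h₂]⟩
  · rintro ⟨p, h, hp⟩
    rw [map_comp_toHom f t h]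
    exact (toHom_eq_iff _ _).2 ⟨Iso.refl _, by simp, by simp [hp]⟩

variable (M) in
theorem IsDominion.of_isIso {X Y : C} (f : X ⟶ Y) [IsIso f] : M f :=
  M.of_isPullback (IsPullback.of_vert_isIso (fst := f) (snd := f) (f := 𝟙 Y) (g := 𝟙 Y) ⟨rfl⟩)
    (M.id_mem Y)

end Dominion

/-! ### Coproducts of two objects, and `0 ⟶ 1` as an equalizer -/

section BoolCoproducts

theorem nonempty_isColimit_cofan_bool {X : C} [HasBinaryCoproduct X X] :
    Nonempty (IsColimit (Cofan.mk (f := fun _ : Bool => X) (X ⨿ X)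
      fun b => Bool.rec coprod.inl coprod.inr b)) :=
  ⟨Cofan.IsColimit.mk _ (fun s => coprod.desc (s.inj false) (s.inj true))
    (fun s b => by cases b; exacts [coprod.inl_desc _ _, coprod.inr_desc _ _])
    (fun s m hm => coprod.hom_ext ((hm false).trans (coprod.inl_desc _ _).symm)
      ((hm true).trans (coprod.inr_desc _ _).symm))⟩

theorem hasBinaryCoproduct_of_hasCoproduct_bool {X Y : C}
    [HasCoproduct fun b => (Bool.rec X Y b : C)] : HasBinaryCoproduct X Y := by
  have h := coproductIsCoproduct fun b => (Bool.rec X Y b : C)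
  refine ⟨⟨_, BinaryCofan.isColimitMk (inl := Cofan.inj _ false) (inr := Cofan.inj _ true)
    (fun s => Cofan.IsColimit.desc h fun b => Bool.rec s.inl s.inr b) (fun s => ?_) (fun s => ?_)
    (fun s m h₁ h₂ => Cofan.IsColimit.hom_ext h _ _ fun b => ?_)⟩⟩
  · exact Cofan.IsColimit.fac h _ false
  · exact Cofan.IsColimit.fac h _ true
  · rw [Cofan.IsColimit.fac]
    cases b
    · exact h₁
    · exact h₂

/-- Any fork over the two injections `1 ⟶ 1 + 1` factors through their pullback, which is initial;
so `0 ⟶ 1` is their equalizer. -/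
theorem HasDisjointFiniteCoproducts.isRegularMono_initial_to [HasTerminal C]
    (hD : HasDisjointFiniteCoproducts C) [HasInitial C] [HasStrictInitialObjects C] : IsRegularMono (initial.to (⊤_ C)) := by
  have := hD.hasFiniteCoproducts
  have hc := coproductIsCoproduct fun _ : Bool => ⊤_ C
  obtain ⟨Z, p, q, h, ⟨hZ⟩⟩ := hD.isPullback_initial _ hc (i := false) (j := true) (by simp)
  exact ⟨⟨{
    Z := _
    left := Sigma.ι (fun _ : Bool => ⊤_ C) false
    right := Sigma.ι (fun _ : Bool => ⊤_ C) true
    w := initialIsInitial.hom_ext _ _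
    isLimit := Fork.IsLimit.mk _ (fun s => h.lift s.ι s.ι s.condition ≫ hZ.to _)
      (fun s => Subsingleton.elim _ _) (fun s m _ => initialIsInitial.strict_hom_ext _ _) }⟩⟩

end BoolCoproducts

/-! ### Consequences of having diagonals in `M` -/

section Equalizers

variable [HasBinaryProducts C]

theorem isPullback_diag_of_isLimit {X A E : C} {f g : X ⟶ A} {e : E ⟶ X} {w : e ≫ f = e ≫ g}
    (h : IsLimit (Fork.ofι e w)) : IsPullback (e ≫ f) e (diag A) (prod.lift f g) := by
  refine ⟨⟨by ext <;> simp [w]⟩, ⟨PullbackCone.IsLimit.mk _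
    (fun s => Fork.IsLimit.lift h s.snd ?_) (fun s => ?_) (fun s => ?_) (fun s m _ hm => ?_)⟩⟩
  · have h₁ := s.condition =≫ prod.fst
    have h₂ := s.condition =≫ prod.snd
    simp only [Category.assoc, prod.lift_fst, prod.lift_snd, Category.comp_id] at h₁ h₂
    rw [← h₁, ← h₂]
  · have h₁ := s.condition =≫ prod.fst
    simp only [Category.assoc, prod.lift_fst, Category.comp_id] at h₁
    exact (reassoc_of% (Fork.IsLimit.lift_ι' h s.snd _)) f |>.trans h₁.symm
  · exact Fork.IsLimit.lift_ι' h _ _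
  · exact Fork.IsLimit.hom_ext h (hm.trans (Fork.IsLimit.lift_ι' h _ _).symm)

theorem hasLimit_parallelPair_of_isPullback {X A E : C} {f g : X ⟶ A} {p : E ⟶ A} {e : E ⟶ X}
    (h : IsPullback p e (diag A) (prod.lift f g)) : HasLimit (parallelPair f g) := by
  have h₁ := h.w =≫ prod.fst
  have h₂ := h.w =≫ prod.snd
  simp only [Category.assoc, prod.lift_fst, prod.lift_snd, Category.comp_id] at h₁ h₂
  have w : e ≫ f = e ≫ g := h₁.symm.trans h₂
  refine ⟨⟨⟨Fork.ofι e w, Fork.IsLimit.mk _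
    (fun s => h.lift (s.ι ≫ f) s.ι ?_) (fun s => ?_) (fun s m hm => ?_)⟩⟩⟩
  · have := s.condition
    ext <;> simp [this]
  · exact h.lift_snd _ _ _
  · have hm' : m ≫ e = s.ι := hm
    apply h.hom_ext
    · simp [h₁, reassoc_of% hm']
    · simp [hm']

theorem isPullback_fst_map {X Y : C} (f : X ⟶ Y) (Q : C) :
    IsPullback (prod.fst : X ⨯ Q ⟶ X) (prod.map f (𝟙 Q)) f prod.fst := by
  refine ⟨⟨by simp⟩, ⟨PullbackCone.IsLimit.mk _ (fun s => prod.lift s.fst (s.snd ≫ prod.snd))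
    (fun s => prod.lift_fst _ _) (fun s => ?_) (fun s m h₁ h₂ => ?_)⟩⟩
  · ext <;> simp [prod.lift_fst, prod.lift_snd, s.condition]
  · ext <;> simp [prod.lift_fst, prod.lift_snd, ← h₁, ← h₂]

variable [IsDominion M]

theorem IsDominion.of_isRegularMono (hM : ∀ A : C, M (diag A))
    {X Y : C} (f : X ⟶ Y) [IsRegularMono f] : M f :=
  M.of_isPullback (isPullback_diag_of_isLimit (IsRegularMono.isLimit f)) (hM _)

theorem IsDominion.of_section (hM : ∀ A : C, M (diag A))
    {X Y : C} (s : X ⟶ Y) (r : Y ⟶ X) (h : s ≫ r = 𝟙 X) : M s :=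
  have : IsSplitMono s := ⟨⟨⟨r, h⟩⟩⟩
  have : IsRegularMono s := inferInstance
  IsDominion.of_isRegularMono hM s

theorem IsDominion.hasPullbacks (hM : ∀ A : C, M (diag A)) : HasPullbacks C := by
  have : HasEqualizers C := by
    refine @hasEqualizers_of_hasLimit_parallelPair C _ (@fun X A f g => ?_)
    have := M.hasPullback (prod.lift f g) (hM A)
    exact hasLimit_parallelPair_of_isPullback (IsPullback.of_hasPullback _ _)
  exact hasPullbacks_of_hasBinaryProducts_of_hasEqualizers C

theorem IsDominion.lift_mem (hM : ∀ A : C, M (diag A)) {A X Y : C} {f : A ⟶ X} (hf : M f)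
    (g : A ⟶ Y) : M (prod.lift f g) := by
  have h : prod.lift f g = prod.lift (𝟙 A) g ≫ prod.map f (𝟙 Y) := by simp
  rw [h]
  exact M.comp_mem _ _ (IsDominion.of_section hM _ prod.fst (prod.lift_fst _ _))
    (M.of_isPullback (isPullback_fst_map f Y) hf)

end Equalizers

/-! ### Coproducts in a partial cartesian closed category with equality -/

section PartialExponentials

variable [HasTerminal C] [HasBinaryProducts C] [IsDominion M]

theorem IsPCCC.hom_ext (hC : IsPCCC M) {ι : Type*} {S : ι → C} {c : Cofan S} (hc : IsColimit c)
    (d : C) {Y : C} (f g : (Par.mk (c.pt ⨯ d) : Par M) ⟶ Par.mk Y)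
    (h : ∀ i, (embedding M).map (prod.map (c.inj i) (𝟙 d)) ≫ f =
      (embedding M).map (prod.map (c.inj i) (𝟙 d)) ≫ g) : f = g := by
  have := hC d
  let adj := Adjunction.ofIsLeftAdjoint (prod.functor.flip.obj d ⋙ embedding M)
  apply (adj.homEquiv c.pt ⟨Y⟩).injective
  refine Cofan.IsColimit.hom_ext hc _ _ fun i => ?_
  exact (adj.homEquiv_naturality_left _ _).symm.trans
    ((congrArg _ (h i)).trans (adj.homEquiv_naturality_left _ _))

theorem IsPCCC.exists_hom (hC : IsPCCC M) {ι : Type*} {S : ι → C} {c : Cofan S}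
    (hc : IsColimit c) (d : C) {Y : C} (f : ∀ i, (Par.mk (S i ⨯ d) : Par M) ⟶ Par.mk Y) :
    ∃ g : (Par.mk (c.pt ⨯ d) : Par M) ⟶ Par.mk Y,
      ∀ i, (embedding M).map (prod.map (c.inj i) (𝟙 d)) ≫ g = f i := by
  have := hC d
  let adj := Adjunction.ofIsLeftAdjoint (prod.functor.flip.obj d ⋙ embedding M)
  let k : c.pt ⟶ (prod.functor.flip.obj d ⋙ embedding M).rightAdjoint.obj ⟨Y⟩ :=
    Cofan.IsColimit.desc hc fun i => adj.homEquiv (S i) ⟨Y⟩ (f i)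
  refine ⟨(adj.homEquiv c.pt ⟨Y⟩).symm k, fun i => ?_⟩
  refine (adj.homEquiv_naturality_left_symm (c.inj i) k).symm.trans ?_
  rw [Cofan.IsColimit.fac]
  exact (adj.homEquiv (S i) ⟨Y⟩).symm_apply_apply _

/-- Spans on the products `S i ⨯ d` extend along the injections of a coproduct of the `S i`. -/
theorem IsPCCC.exists_span (hC : IsPCCC M) {ι : Type*} {S : ι → C} {c : Cofan S}
    (hc : IsColimit c) (d : C) {Y : C} (s : ∀ i, PartialSpan M (S i ⨯ d) Y) :
    ∃ t : PartialSpan M (c.pt ⨯ d) Y, ∀ i, ∃ p : (s i).dom ⟶ t.dom,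
      IsPullback p (s i).incl t.incl (prod.map (c.inj i) (𝟙 d)) ∧ p ≫ t.map = (s i).map := by
  obtain ⟨g, hg⟩ := hC.exists_hom hc d fun i => (s i).toHom
  obtain ⟨t, rfl⟩ := PartialSpan.exists_toHom_eq g
  exact ⟨t, fun i => (PartialSpan.map_comp_toHom_eq_iff _ _ _).1 (hg i)⟩

/-- A span on `c.pt ⨯ d` is determined by its restrictions along the injections. -/
theorem IsPCCC.span_ext (hC : IsPCCC M) {ι : Type*} {S : ι → C} {c : Cofan S}
    (hc : IsColimit c) (d : C) {Y : C} (s : ∀ i, PartialSpan M (S i ⨯ d) Y)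
    (t t' : PartialSpan M (c.pt ⨯ d) Y)
    (h : ∀ i, ∃ p : (s i).dom ⟶ t.dom,
      IsPullback p (s i).incl t.incl (prod.map (c.inj i) (𝟙 d)) ∧ p ≫ t.map = (s i).map)
    (h' : ∀ i, ∃ p : (s i).dom ⟶ t'.dom,
      IsPullback p (s i).incl t'.incl (prod.map (c.inj i) (𝟙 d)) ∧ p ≫ t'.map = (s i).map) :
    ∃ e : t.dom ≅ t'.dom, e.hom ≫ t'.incl = t.incl ∧ e.hom ≫ t'.map = t.map := by
  rw [← PartialSpan.toHom_eq_iff]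
  refine hC.hom_ext hc d _ _ fun i => ?_
  exact ((PartialSpan.map_comp_toHom_eq_iff _ t (s i)).2 (h i)).trans
    ((PartialSpan.map_comp_toHom_eq_iff _ t' (s i)).2 (h' i)).symm

/-- Every object embeds, by a member of `M`, into an object to which every object maps as soon as
it has a partial morphism into the given one. -/
theorem IsPCCCWithEquality.exists_classifier (hC : IsPCCCWithEquality M) (B : C) :
    ∃ (B' : C) (η : B ⟶ B'), M η ∧ ∀ A : C, PartialSpan M A B → Nonempty (A ⟶ B') := by
  have := hC.isPCCC (⊤_ C)
  let F := prod.functor.flip.obj (⊤_ C) ⋙ embedding M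
  let adj : F ⊣ F.rightAdjoint := Adjunction.ofIsLeftAdjoint F
  let φ : F.obj B ⟶ ⟨B⟩ := (embedding M).map (prod.fst : B ⨯ ⊤_ C ⟶ B)
  let η := adj.homEquiv B ⟨B⟩ φ
  refine ⟨F.rightAdjoint.obj ⟨B⟩, η, ?_, fun A s => ⟨adj.homEquiv A ⟨B⟩
    ((embedding M).map (prod.fst : A ⨯ ⊤_ C ⟶ A) ≫ s.toHom)⟩⟩
  obtain ⟨t, ht⟩ := PartialSpan.exists_toHom_eq
    (adj.counit.app ⟨B⟩ : (Par.mk (F.rightAdjoint.obj ⟨B⟩ ⨯ ⊤_ C) : Par M) ⟶ ⟨B⟩)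
  have hη : (embedding M).map (prod.map η (𝟙 (⊤_ C))) ≫ t.toHom =
      (PartialSpan.ofHom M (prod.fst : B ⨯ ⊤_ C ⟶ B)).toHom := by
    rw [ht]
    have := (adj.homEquiv B ⟨B⟩).symm_apply_apply φ
    rw [adj.homEquiv_counit] at this
    exact this
  obtain ⟨p, hp, hpt⟩ := (PartialSpan.map_comp_toHom_eq_iff _ _ _).1 hη
  have hm : M (prod.map η (𝟙 (⊤_ C))) := by
    have hw : p ≫ t.incl = prod.map η (𝟙 (⊤_ C)) := hp.w.trans (Category.id_comp _)
    rw [← hw]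
    -- The evaluation restricts along `η` to the total projection, an isomorphism; thus `p` is a
    -- section, so `η ⨯ 1` is a section followed by a domain inclusion.
    have hs : p ≫ t.map ≫ (Limits.prod.rightUnitor B).inv = 𝟙 (B ⨯ ⊤_ C) :=
      ((reassoc_of% hpt) _).trans (Limits.prod.rightUnitor B).hom_inv_id
    exact M.comp_mem _ _ (IsDominion.of_section hC.diag_mem p _ hs) t.mem
  have hη' : η = (Limits.prod.rightUnitor B).inv ≫ prod.map η (𝟙 (⊤_ C)) ≫ (Limits.prod.rightUnitor _).hom := by
    rw [Iso.eq_inv_comp]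
    exact (prod.map_fst _ _).symm
  rw [hη']
  exact M.comp_mem _ _ (IsDominion.of_isIso M _) (M.comp_mem _ _ hm (IsDominion.of_isIso M _))

/-- Coproducts are universal: their pullbacks along any morphism are coproducts. -/
theorem IsPCCCWithEquality.nonempty_isColimit_of_isPullback (hC : IsPCCCWithEquality M)
    {ι : Type*} {S : ι → C} {c : Cofan S} (hc : IsColimit c) {d : C} (h : d ⟶ c.pt)
    {D : ι → C} (k : ∀ i, D i ⟶ d) (g : ∀ i, D i ⟶ S i)
    (hp : ∀ i, IsPullback (g i) (k i) (c.inj i) h) :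
    Nonempty (IsColimit (Cofan.mk d k)) := by
  have hgraph : M (prod.lift h (𝟙 d)) := IsDominion.of_section hC.diag_mem _ prod.snd (prod.lift_snd _ _)
  have hpb (i : ι) : IsPullback (k i) (prod.lift (g i) (k i)) (prod.lift h (𝟙 d))
      (prod.map (c.inj i) (𝟙 d)) := by
    refine ⟨⟨by ext <;> simp [(hp i).w]⟩, ⟨PullbackCone.IsLimit.mk _
      (fun s => (hp i).lift (s.snd ≫ prod.fst) s.fst ?_) (fun s => ?_) (fun s => ?_)
      (fun s m hm hm' => ?_)⟩⟩
    · simpa [prod.lift_fst] using (s.condition =≫ prod.fst).symm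
    · simp
    · have := s.condition =≫ prod.snd
      simp only [Category.assoc, prod.lift_snd, prod.map_snd, Category.comp_id] at this
      ext <;> simp [this, prod.lift_fst, prod.lift_snd]
    · apply (hp i).hom_ext
      · simp [← hm', prod.lift_fst]
      · simp [hm]
  have hmem (i : ι) : M (prod.lift (g i) (k i)) := M.of_isPullback (hpb i) hgraph
  have huniq {Y : C} (u u' : d ⟶ Y) (huu : ∀ i, k i ≫ u = k i ≫ u') : u = u' := by
    -- Regard `u` and `u'` as partial maps defined on the graph of `h`. The second component of the
    -- graph is the identity, which forces `e` to be the identity.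
    obtain ⟨e, h₁, h₂⟩ := hC.isPCCC.span_ext hc d
      (fun i => ⟨D i, prod.lift (g i) (k i), hmem i, k i ≫ u⟩)
      ⟨d, prod.lift h (𝟙 d), hgraph, u⟩ ⟨d, prod.lift h (𝟙 d), hgraph, u'⟩
      (fun i => ⟨k i, hpb i, rfl⟩) (fun i => ⟨k i, hpb i, (huu i).symm⟩)
    have he := h₁ =≫ prod.snd
    simp only [Category.assoc, prod.lift_snd, Category.comp_id] at he
    simpa [he] using h₂.symm
  have hex {Y : C} (y : ∀ i, D i ⟶ Y) : ∃ u : d ⟶ Y, ∀ i, k i ≫ u = y i := by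
    obtain ⟨t, ht⟩ := hC.isPCCC.exists_span hc d
      (fun i => ⟨D i, prod.lift (g i) (k i), hmem i, y i⟩)
    choose p hp hpt using ht
    -- With values in `1`, a partial map is just its domain: this identifies the glued domain with
    -- the graph of `h`.
    obtain ⟨e, he, -⟩ := hC.isPCCC.span_ext hc d
      (fun i => ⟨D i, prod.lift (g i) (k i), hmem i, terminal.from _⟩)
      ⟨d, prod.lift h (𝟙 d), hgraph, terminal.from _⟩ ⟨t.dom, t.incl, t.mem, terminal.from _⟩
      (fun i => ⟨k i, hpb i, Subsingleton.elim _ _⟩)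
      (fun i => ⟨p i, hp i, Subsingleton.elim _ _⟩)
    refine ⟨e.hom ≫ t.map, fun i => ?_⟩
    have : Mono t.incl := IsDominion.mono _ t.mem
    have hk : k i ≫ e.hom = p i := by
      rw [← cancel_mono t.incl, Category.assoc]
      exact (congrArg (k i ≫ ·) he).trans ((hpb i).w.trans (hp i).w.symm)
    rw [← Category.assoc, hk]
    exact hpt i
  choose desc hdesc using @hex
  exact ⟨Cofan.IsColimit.mk _ (fun s => desc s.inj) (fun s i => hdesc s.inj i)
    (fun s m hm => huniq _ _ fun i => (hm i).trans (hdesc s.inj i).symm)⟩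

theorem IsPCCCWithEquality.hasStrictInitialObjects (hC : IsPCCCWithEquality M) :
    HasStrictInitialObjects C where
  out {I A} f hI := by
    have hc : IsColimit (Cofan.mk (f := fun i : PEmpty.{1} => i.elim) I fun i => i.elim) :=
      Cofan.IsColimit.mk _ (fun s => hI.to s.pt) (fun s i => i.elim) (fun s m _ => hI.hom_ext _ _)
    obtain ⟨hA⟩ := hC.nonempty_isColimit_of_isPullback hc f (D := fun i : PEmpty.{1} => i.elim)
      (fun i => i.elim) (fun i => i.elim) (fun i => i.elim)
    have hA' : IsInitial A := IsInitial.ofUniqueHom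
      (fun Y => Cofan.IsColimit.desc hA fun i => i.elim)
      (fun Y m => Cofan.IsColimit.hom_ext hA _ _ fun i => i.elim)
    exact ⟨hI.to A, hA'.hom_ext _ _, hI.hom_ext _ _⟩

/-- If the copower of the terminal object by `ι` exists, then a family of objects indexed by `ι`
which all embed into a common object has a coproduct. -/
theorem IsPCCCWithEquality.hasCoproduct_of_mem (hC : IsPCCCWithEquality M) {ι : Type*}
    {c : Cofan fun _ : ι => ⊤_ C} (hc : IsColimit c) {Q : C} {D : ι → C} (k : ∀ i, D i ⟶ Q)
    (hk : ∀ i, M (k i)) : HasCoproduct D := by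
  have hmem (i : ι) : M (prod.lift (terminal.from (D i)) (k i)) := by
    have h : prod.lift (terminal.from (D i)) (k i) = k i ≫ (Limits.prod.leftUnitor Q).inv := by
      rw [Iso.eq_comp_inv]
      exact prod.lift_snd _ _
    rw [h]
    exact M.comp_mem _ _ (hk i) (IsDominion.of_isIso M _)
  obtain ⟨t, ht⟩ := hC.isPCCC.exists_span hc Q
    (fun i => ⟨D i, prod.lift (terminal.from (D i)) (k i), hmem i, terminal.from _⟩)
  choose p hp _ using ht
  -- The glued domain lies over the copower of `1`, with fibre `D i` over the `i`-th injection, so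
  -- universality makes it the coproduct.
  obtain ⟨h⟩ := hC.nonempty_isColimit_of_isPullback hc (t.incl ≫ prod.fst) p
    (fun i => _) fun i => (hp i).flip.paste_horiz (isPullback_fst_map (c.inj i) Q)
  exact ⟨⟨_, h⟩⟩

/-- By strictness, `0 ⟶ A` is the pullback of `0 ⟶ 1` along `A ⟶ 1`. -/
theorem IsPCCCWithEquality.initial_to_mem (hC : IsPCCCWithEquality M) [HasInitial C]
    [IsRegularMono (initial.to (⊤_ C))] (A : C) : M (initial.to A) := by
  have := hC.hasStrictInitialObjects
  refine M.of_isPullback (f := terminal.from A) (f' := 𝟙 _) ?_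
    (IsDominion.of_isRegularMono hC.diag_mem (initial.to (⊤_ C)))
  exact ⟨⟨Subsingleton.elim _ _⟩, ⟨PullbackCone.IsLimit.mk _ (fun s => s.fst)
    (fun s => initialIsInitial.strict_hom_ext _ _)
    (fun s => (IsInitial.ofStrict s.fst initialIsInitial).hom_ext _ _)
    (fun s m _ _ => initialIsInitial.strict_hom_ext _ _)⟩⟩

theorem IsPCCCWithEquality.hasBinaryCoproducts (hC : IsPCCCWithEquality M) [HasInitial C]
    [HasBinaryCoproduct (⊤_ C) (⊤_ C)] [IsRegularMono (initial.to (⊤_ C))] :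
    HasBinaryCoproducts C := by
  refine @hasBinaryCoproducts_of_hasColimit_pair C _ (@fun A B => ?_)
  obtain ⟨A', α, hα, hA⟩ := hC.exists_classifier A
  obtain ⟨B', β, hβ, hB⟩ := hC.exists_classifier B
  -- Totalizing the nowhere-defined partial maps gives `B ⟶ A'` and `A ⟶ B'`, so both objects embed
  -- in `A' ⨯ B'`.
  obtain ⟨a⟩ := hA B ⟨⊥_ C, initial.to B, hC.initial_to_mem B, initial.to A⟩
  obtain ⟨b⟩ := hB A ⟨⊥_ C, initial.to A, hC.initial_to_mem A, initial.to B⟩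
  obtain ⟨hc⟩ := nonempty_isColimit_cofan_bool (X := ⊤_ C)
  have hab : M (prod.lift a β) := by
    have h : prod.lift a β = prod.lift β a ≫ (Limits.prod.braiding _ _).hom := by
      ext <;> simp [prod.lift_fst, prod.lift_snd]
    rw [h]
    exact M.comp_mem _ _ (IsDominion.lift_mem hC.diag_mem hβ a) (IsDominion.of_isIso M _)
  have := hC.hasCoproduct_of_mem hc (D := fun i => Bool.rec A B i)
    (fun i => Bool.rec (prod.lift α b) (prod.lift a β) i)
    (fun i => by cases i; exacts [IsDominion.lift_mem hC.diag_mem hα b, hab])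
  exact hasBinaryCoproduct_of_hasCoproduct_bool

/-- If `0 ⟶ 1` is a regular monomorphism, then distinct injections of a coproduct have initial
pullback. -/
theorem IsPCCCWithEquality.nonempty_isInitial_of_comp_inj_eq (hC : IsPCCCWithEquality M)
    [HasInitial C] [HasBinaryCoproduct (⊤_ C) (⊤_ C)] [IsRegularMono (initial.to (⊤_ C))]
    {ι : Type*} {X : ι → C} {c : Cofan X} (hc : IsColimit c) {i j : ι} (hij : i ≠ j) {Z : C}
    (p : Z ⟶ X i) (q : Z ⟶ X j) (h : p ≫ c.inj i = q ≫ c.inj j) : Nonempty (IsInitial Z) := by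
  classical
  have := hC.hasStrictInitialObjects
  let f := IsRegularMono.left (initial.to (⊤_ C))
  let g := IsRegularMono.right (initial.to (⊤_ C))
  -- `d` sends the `i`-th summand to `f` and all others to `g`, so `Z` equalizes `f` and `g` and
  -- hence maps to `0`.
  let d : c.pt ⟶ _ := Cofan.IsColimit.desc hc fun k =>
    if k = i then terminal.from (X k) ≫ f else terminal.from (X k) ≫ g
  have hi : c.inj i ≫ d = terminal.from _ ≫ f := by simp [d]
  have hj : c.inj j ≫ d = terminal.from _ ≫ g := by simp [d, hij.symm]
  have hZ : terminal.from Z ≫ f = terminal.from Z ≫ g := by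
    have := h =≫ d
    rwa [Category.assoc, Category.assoc, hi, hj, ← Category.assoc, ← Category.assoc,
      terminal.comp_from, terminal.comp_from] at this
  exact ⟨IsInitial.ofStrict (IsRegularMono.lift _ _ hZ) initialIsInitial⟩

/-- Coproduct injections are monomorphisms as soon as distinct ones have initial pullbacks. -/
theorem IsPCCCWithEquality.mono_inj (hC : IsPCCCWithEquality M) (hD : HasDisjointFiniteCoproducts C)
    {ι : Type} [Finite ι] {X : ι → C} {c : Cofan X} (hc : IsColimit c) (i : ι) :
    Mono (c.inj i) := by
  classical
  have := IsDominion.hasPullbacks hC.diag_mem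
  -- `X i` is the coproduct of its kernel pair under `c.inj i` and initial objects. This inverts the
  -- second projection; the inverse is the diagonal, so the two projections agree.
  obtain ⟨h⟩ := hC.nonempty_isColimit_of_isPullback hc (c.inj i)
    (fun j => pullback.snd (c.inj j) (c.inj i)) (fun j => pullback.fst (c.inj j) (c.inj i))
    (fun j => IsPullback.of_hasPullback _ _)
  have hI (j : ι) (hj : j ≠ i) : Nonempty (IsInitial (pullback (c.inj j) (c.inj i))) := by
    obtain ⟨Z, p, q, hpb, ⟨hZ⟩⟩ := hD.isPullback_initial c hc hj
    exact ⟨hZ.ofIso hpb.isoPullback⟩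
  let δ : X i ⟶ pullback (c.inj i) (c.inj i) := pullback.lift (𝟙 _) (𝟙 _) rfl
  let y (j : ι) : pullback (c.inj j) (c.inj i) ⟶ pullback (c.inj i) (c.inj i) :=
    if hj : j = i then eqToHom (by rw [hj]) else (hI j hj).some.to _
  let u : X i ⟶ pullback (c.inj i) (c.inj i) := Cofan.IsColimit.desc h y
  have hu : pullback.snd (c.inj i) (c.inj i) ≫ u = 𝟙 _ :=
    (Cofan.IsColimit.fac h y i).trans (by simp [y])
  have hδ : δ = u := by
    have hδs : δ ≫ pullback.snd _ _ = 𝟙 _ := pullback.lift_snd _ _ _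
    rw [← Category.comp_id δ, ← hu, reassoc_of% hδs]
  have hfs : pullback.fst (c.inj i) (c.inj i) = pullback.snd (c.inj i) (c.inj i) := by
    have hδf : δ ≫ pullback.fst _ _ = 𝟙 _ := pullback.lift_fst _ _ _
    rw [← Category.id_comp (pullback.fst _ _), ← hu, Category.assoc, ← hδ, hδf, Category.comp_id]
  refine ⟨fun a b hab => ?_⟩
  rw [← pullback.lift_fst a b hab, hfs, pullback.lift_snd]

end PartialExponentials

end PartialCat

theorem proposition5 {C : Type u} [Category.{v} C] [HasTerminal C] [HasBinaryProducts C]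
    (M : MorphismProperty C) [PartialCat.IsDominion M] (hC : PartialCat.IsPCCCWithEquality M) :
    List.TFAE
      [PartialCat.HasDisjointFiniteCoproducts C,
        HasFiniteCoproducts C ∧ ∀ (ι : Type) [Finite ι] (X : ι → C), CoproductDisjoint X,
        ∃ _ : HasInitial C,
          HasBinaryCoproduct (⊤_ C) (⊤_ C) ∧ IsRegularMono (initial.to (⊤_ C)),
        ∃ _ : HasInitial C, HasStrictInitialObjects C ∧
          HasBinaryCoproduct (⊤_ C) (⊤_ C) ∧ IsRegularMono (initial.to (⊤_ C))] := by
  have hs := hC.hasStrictInitialObjects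
  tfae_have 1 → 2 := fun hD => by
    refine ⟨hD.hasFiniteCoproducts, fun ι _ X => ⟨fun {c} hc {i j} hij s hl => ?_,
      fun hc i => hC.mono_inj hD hc i⟩⟩
    obtain ⟨Z, p, q, hpb, ⟨hZ⟩⟩ := hD.isPullback_initial c hc hij
    exact ⟨IsInitial.ofStrict (hpb.lift s.fst s.snd s.condition) hZ⟩
  tfae_have 2 → 1 := fun ⟨hF, hD⟩ => by
    have := PartialCat.IsDominion.hasPullbacks hC.diag_mem
    refine ⟨hF, fun {ι} _ {X} c hc {i j} hij => ?_⟩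
    have := hD ι X
    exact ⟨_, _, _, IsPullback.of_hasPullback (c.inj i) (c.inj j),
      CoproductDisjoint.nonempty_isInitial_of_ne hc hij _ (pullback.isLimit _ _)⟩
  tfae_have 1 → 4 := fun hD => by
    have := hD.hasFiniteCoproducts
    have : HasInitial C := inferInstance
    exact ⟨this, hs, inferInstance, hD.isRegularMono_initial_to⟩
  tfae_have 4 → 3 := fun ⟨h, _, h'⟩ => ⟨h, h'⟩
  tfae_have 3 → 1 := fun ⟨_, _, _⟩ => by
    have := PartialCat.IsDominion.hasPullbacks hC.diag_mem
    have := hC.hasBinaryCoproducts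
    exact ⟨hasFiniteCoproducts_of_has_binary_and_initial, @fun ι _ X c hc i j hij =>
      ⟨_, _, _, IsPullback.of_hasPullback (c.inj i) (c.inj j),
        hC.nonempty_isInitial_of_comp_inj_eq hc hij _ _ pullback.condition⟩⟩
  tfae_finish
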